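/- Let $\mathbb N^*=\beta\mathbb N\setminus\mathbb N$ be the remainder of the Stone–Čech compactification of the discrete space $\mathbb N$. A subset $A$ of a topological space is called a $P$-set if $A\subseteq\operatorname{int}\bigl(\bigcap_{n}G_n\bigr)$ for every sequence $(G_n)_{n\ge1}$ of open sets with $A\subseteq G_n$ for all $n$. Let $\mathcal P$ be the system of all closed nowhere dense $P$-sets in $\mathbb N^*$, let $Y=\bigcup_{P\in\mathcal P}P$ with the subspace topology, and let $X$ be the set of all continuous maps $x:\mathbb N^*\to\{0,1\}$ with the topology of uniform convergence on the sets of $\mathcal P$. A topological space is called countably compact if every countable open cover of it has a finite subcover. It is called $\alpha$-favourable if the player $\alpha$ has a winning strategy in the Choquet game, in which the players $\beta$ and $\alpha$ alternately choose nonempty open sets $U_0\supseteq V_1\supseteq U_1\supseteq V_2\supseteq\cdots$ ($\beta$ moves first and chooses the $U_n$, $\alpha$ chooses the $V_n$), and $\alpha$ wins if $\bigcap_{n\ge1}V_n\neq\emptyset$. Then: 1. for every $x\in X$ the sets $\{x'\in X: x'(t)=x(t)\ \text{for all } t\in P\}$, $P\in\mathcal P$, form a base of neighbourhoods of $x$ in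 $X$; 2. $Y$ is dense in $\mathbb N^*$ and countably compact; 3. $X$ is $\alpha$-favourable; 4. the function $f:X\times Y\to\mathbb R$, $f(x,y)=x(y)$, is separately continuous, and it is discontinuous (as a function on the product space $X\times Y$) at every point of $X\times Y$. -/

import Mathlib

open Set Topology
open scoped UniformConvergence

/-- The remainder `ℕ* = βℕ ∖ ℕ` of the Stone–Čech compactification of the discrete space `ℕ`. -/
abbrev NStar : Type := ↥((Set.range (stoneCechUnit : ℕ → StoneCech ℕ))ᶜ)

/-- `A` is a `P`-set: whenever `A` lies in every term of a sequence of open sets, it lies in the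
interior of their intersection. -/
def IsPSet {T : Type*} [TopologicalSpace T] (A : Set T) : Prop :=
  ∀ G : ℕ → Set T, (∀ n, IsOpen (G n)) → (∀ n, A ⊆ G n) → A ⊆ interior (⋂ n, G n)

/-- The system of all closed nowhere dense `P`-sets of `T`. -/
def nowhereDensePSets (T : Type*) [TopologicalSpace T] : Set (Set T) :=
  {P | IsClosed P ∧ IsNowhereDense P ∧ IsPSet P}

/-- The continuous maps `x : ℕ* → {0,1} ⊆ ℝ`, with the topology of uniform convergence on the
closed nowhere dense `P`-sets of `ℕ*`. -/
abbrev StarMaps : Type :=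
  {x : NStar →ᵤ[nowhereDensePSets NStar] ↥({0, 1} : Set ℝ) //
    Continuous (UniformOnFun.toFun (nowhereDensePSets NStar) x)}

/-- The map `ℕ* → {0,1}` underlying an element of `StarMaps`. -/
def StarMaps.map (x : StarMaps) : NStar → ↥({0, 1} : Set ℝ) :=
  UniformOnFun.toFun (nowhereDensePSets NStar) x.1

/-- The union of all closed nowhere dense `P`-sets of `ℕ*`. -/
def starUnion : Set NStar := ⋃₀ nowhereDensePSets NStar

/-- The evaluation map `f(x, y) = x(y)`. -/
def starEval (x : StarMaps) (y : ↥starUnion) : ℝ := (x.map (y : NStar) : ℝ)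

/-- Every countable open cover has a finite subcover. -/
def IsCountablyCompactSpace (T : Type*) [TopologicalSpace T] : Prop :=
  ∀ U : ℕ → Set T, (∀ n, IsOpen (U n)) → (⋃ n, U n) = univ →
    ∃ s : Finset ℕ, (⋃ n ∈ s, U n) = univ

/-- Nonempty open sets: the moves of the Choquet game. -/
abbrev NonemptyOpen (T : Type*) [TopologicalSpace T] : Type _ :=
  {U : Set T // IsOpen U ∧ U.Nonempty}

/-- A strategy for the player `α` in the Choquet game on `T`. The player `β` moves first, and
`α` answers the moves `U 0, …, U n` of `β` by a nonempty open subset of `U n`. -/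
structure ChoquetStrategy (T : Type*) [TopologicalSpace T] where
  move : (n : ℕ) → (Fin (n + 1) → NonemptyOpen T) → NonemptyOpen T
  move_subset : ∀ n U, (move n U : Set T) ⊆ (U (Fin.last n) : Set T)

/-- The answer of `α` to the first `n + 1` moves of `β`. -/
def ChoquetStrategy.reply {T : Type*} [TopologicalSpace T] (σ : ChoquetStrategy T)
    (U : ℕ → NonemptyOpen T) (n : ℕ) : Set T :=
  (σ.move n (fun i => U i) : Set T)

/-- In every play in which `β` obeys the rules and `α` follows `σ`, the intersection of the sets
chosen by `α` is nonempty. -/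
def ChoquetStrategy.IsWinning {T : Type*} [TopologicalSpace T] (σ : ChoquetStrategy T) : Prop :=
  ∀ U : ℕ → NonemptyOpen T, (∀ n, (U (n + 1) : Set T) ⊆ σ.reply U n) →
    (⋂ n, σ.reply U n).Nonempty

/-- The player `α` has a winning strategy in the Choquet game on `T`. -/
def IsAlphaFavourable (T : Type*) [TopologicalSpace T] : Prop :=
  ∃ σ : ChoquetStrategy T, σ.IsWinning

/-- Continuity in each variable separately. -/
def IsSeparatelyContinuous {S T Z : Type*} [TopologicalSpace S] [TopologicalSpace T]
    [TopologicalSpace Z] (f : S → T → Z) : Prop :=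
  (∀ s, Continuous (fun t => f s t)) ∧ ∀ t, Continuous (fun s => f s t)

/-! Clopen sets of `ℕ*` are handled as subsets of `ℕ` modulo finite sets, and two diagonal arguments
carry the proof: `exists_starSet_separating` separates countable families,
`exists_starSet_subset_iInter` gives pseudo-intersections. Together they show that the closure of a
countable union of members of `𝒫` is again in `𝒫`. So any sequence in `Y` lies in one compact `Q ⊆
Y`, whence countable compactness.

Separation also glues compatible two-valued maps given on countably many closed `P`-sets. In the
Choquet game `α` plays basic neighbourhoods, and gluing their centres gives a point of the
intersection.

For density, each infinite `B` carries a measure with point masses tending to `0` and `μ B = ∞`; the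
sets of finite measure form a `P`-ideal, whose kernel belongs to `𝒫` and meets `B*`.

For discontinuity, a basic neighbourhood of `x` constrains maps only on a nowhere dense `P`, so near
`y` there is a point of `Y` off `P` where the value can be flipped. -/

open Filter

/-! ### Clopen sets of `βℕ` and `ℕ*` -/

/-- The clopen subset of `βℕ` that `A ⊆ ℕ` generates. -/
def stoneCechHull (A : Set ℕ) : Set (StoneCech ℕ) :=
  {t | stoneCechExtend (g := fun n => A.indicator (fun _ => true) n)
    continuous_of_discreteTopology t = true}

theorem isClopen_stoneCechHull (A : Set ℕ) : IsClopen (stoneCechHull A) :=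
  (isClopen_discrete {true}).preimage (continuous_stoneCechExtend _)

@[simp]
theorem stoneCechUnit_mem_hull {A : Set ℕ} {n : ℕ} :
    stoneCechUnit n ∈ stoneCechHull A ↔ n ∈ A := by
  by_cases h : n ∈ A <;> simp [stoneCechHull, stoneCechExtend_stoneCechUnit, h]

theorem hull_subset_closure (A : Set ℕ) :
    stoneCechHull A ⊆ closure (stoneCechUnit '' A) := by
  refine (denseRange_stoneCechUnit.open_subset_closure_inter (isClopen_stoneCechHull A).2).trans
    (closure_mono ?_)
  rintro _ ⟨h, n, rfl⟩
  exact ⟨n, stoneCechUnit_mem_hull.1 h, rfl⟩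

theorem hull_subset_of_isClosed {A : Set ℕ} {C : Set (StoneCech ℕ)} (hC : IsClosed C)
    (h : ∀ n ∈ A, stoneCechUnit n ∈ C) : stoneCechHull A ⊆ C :=
  (hull_subset_closure A).trans (closure_minimal (by rintro _ ⟨n, hn, rfl⟩; exact h n hn) hC)

theorem hull_mono {A B : Set ℕ} (h : A ⊆ B) : stoneCechHull A ⊆ stoneCechHull B :=
  hull_subset_of_isClosed (isClopen_stoneCechHull B).1 fun _ hn =>
    stoneCechUnit_mem_hull.2 (h hn)

theorem hull_union (A B : Set ℕ) :
    stoneCechHull (A ∪ B) = stoneCechHull A ∪ stoneCechHull B := by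
  refine Subset.antisymm (hull_subset_of_isClosed
    ((isClopen_stoneCechHull A).1.union (isClopen_stoneCechHull B).1) ?_)
    (union_subset (hull_mono subset_union_left) (hull_mono subset_union_right))
  intro n hn
  simpa using hn

theorem hull_compl (A : Set ℕ) : stoneCechHull Aᶜ = (stoneCechHull A)ᶜ := by
  refine Subset.antisymm (hull_subset_of_isClosed (isClopen_stoneCechHull A).compl.1 ?_) ?_
  · intro n hn
    simpa using hn
  · have : stoneCechHull (A ∪ Aᶜ) = univ := by
      rw [eq_univ_iff_forall]
      have h := denseRange_stoneCechUnit (α := ℕ)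
      intro t
      refine (isClopen_stoneCechHull (A ∪ Aᶜ)).1.closure_subset_iff.2 ?_ (h t)
      rintro _ ⟨n, rfl⟩
      simp
    rw [hull_union] at this
    exact compl_subset_iff_union.2 this

theorem hull_singleton (n : ℕ) : stoneCechHull {n} = {stoneCechUnit n} :=
  Subset.antisymm (hull_subset_of_isClosed isClosed_singleton (by simp)) (by simp)

theorem isOpen_range_stoneCechUnit_nat :
    IsOpen (range (stoneCechUnit : ℕ → StoneCech ℕ)) := by
  rw [← iUnion_singleton_eq_range]
  refine isOpen_iUnion fun n => ?_
  rw [← hull_singleton]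
  exact (isClopen_stoneCechHull _).2

instance NStar.compactSpace : CompactSpace NStar :=
  isCompact_iff_compactSpace.1 isOpen_range_stoneCechUnit_nat.isClosed_compl.isCompact

/-- The clopen subset `A*` of `ℕ*`. -/
def starSet (A : Set ℕ) : Set NStar := Subtype.val ⁻¹' stoneCechHull A

theorem isClopen_starSet (A : Set ℕ) : IsClopen (starSet A) :=
  (isClopen_stoneCechHull A).preimage continuous_subtype_val

theorem starSet_compl (A : Set ℕ) : starSet Aᶜ = (starSet A)ᶜ := by
  rw [starSet, hull_compl]; rfl

theorem starSet_union (A B : Set ℕ) : starSet (A ∪ B) = starSet A ∪ starSet B := by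
  rw [starSet, hull_union]; rfl

theorem starSet_inter (A B : Set ℕ) : starSet (A ∩ B) = starSet A ∩ starSet B := by
  rw [← compl_inj_iff, ← starSet_compl, compl_inter, starSet_union, starSet_compl, starSet_compl,
    compl_inter]

theorem starSet_diff (A B : Set ℕ) : starSet (A \ B) = starSet A \ starSet B := by
  rw [sdiff_eq, starSet_inter, starSet_compl, sdiff_eq]

theorem starSet_eq_empty {A : Set ℕ} : starSet A = ∅ ↔ A.Finite := by
  constructor
  · intro h
    have hc : stoneCechHull A ⊆ ⋃ n : ℕ, stoneCechHull {n} := by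
      intro t ht
      by_contra hn
      have : t ∈ (range (stoneCechUnit : ℕ → StoneCech ℕ))ᶜ := by
        rintro ⟨n, rfl⟩
        exact hn (mem_iUnion.2 ⟨n, by simp⟩)
      exact (h ▸ (show (⟨t, this⟩ : NStar) ∈ starSet A from ht) : _ ∈ (∅ : Set NStar))
    obtain ⟨s, hs⟩ := (isClopen_stoneCechHull A).1.isCompact.elim_finite_subcover _
      (fun n => (isClopen_stoneCechHull {n}).2) hc
    refine s.finite_toSet.subset fun n hn => ?_
    have := hs (stoneCechUnit_mem_hull.2 hn)
    simp only [mem_iUnion, stoneCechUnit_mem_hull, mem_singleton_iff] at this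
    obtain ⟨i, hi, rfl⟩ := this
    exact hi
  · intro h
    refine eq_empty_of_forall_notMem fun t ht => t.2 ?_
    have := hull_subset_of_isClosed (h.image stoneCechUnit).isClosed
      (fun n hn => mem_image_of_mem _ hn) ht
    exact image_subset_range _ _ this

theorem starSet_nonempty {A : Set ℕ} : (starSet A).Nonempty ↔ A.Infinite := by
  rw [nonempty_iff_ne_empty, Ne, starSet_eq_empty]; rfl

theorem starSet_subset {A B : Set ℕ} : starSet A ⊆ starSet B ↔ (A \ B).Finite := by
  rw [← starSet_eq_empty, starSet_diff, sdiff_eq_empty]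

theorem starSet_empty : starSet ∅ = ∅ := starSet_eq_empty.2 finite_empty

/-- By regularity, `t` has a closed neighbourhood inside the open set; its trace on `ℕ` is the
required set. -/
theorem exists_starSet_mem_subset {t : NStar} {G : Set NStar} (hG : IsOpen G) (ht : t ∈ G) :
    ∃ A, t ∈ starSet A ∧ starSet A ⊆ G := by
  obtain ⟨U, hU, rfl⟩ := isOpen_induced_iff.1 hG
  obtain ⟨V, hV, hVc, hVU⟩ := exists_mem_nhds_isClosed_subset (hU.mem_nhds ht)
  refine ⟨stoneCechUnit ⁻¹' V, ?_, ?_⟩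
  · by_contra h
    rw [← mem_compl_iff, ← starSet_compl] at h
    have := closure_mono (s := stoneCechUnit '' (stoneCechUnit ⁻¹' V)ᶜ) (t := Vᶜ)
      (by rintro _ ⟨n, hn, rfl⟩; exact hn) (hull_subset_closure _ h)
    rw [closure_compl] at this
    exact this (mem_interior_iff_mem_nhds.2 hV)
  · intro s hs
    exact hVU (hull_subset_of_isClosed hVc (fun n hn => hn) hs)

theorem exists_starSet_between {K G : Set NStar} (hK : IsClosed K) (hG : IsOpen G) (h : K ⊆ G) :
    ∃ A, K ⊆ starSet A ∧ starSet A ⊆ G := by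
  refine hK.isCompact.induction_on (p := fun s => ∃ A, s ⊆ starSet A ∧ starSet A ⊆ G) ?_ ?_ ?_ ?_
  · exact ⟨∅, empty_subset _, by simp [starSet_empty]⟩
  · rintro s t hst ⟨A, h1, h2⟩
    exact ⟨A, hst.trans h1, h2⟩
  · rintro s t ⟨A, h1, h2⟩ ⟨B, h3, h4⟩
    exact ⟨A ∪ B, by rw [starSet_union]; exact union_subset_union h1 h3,
      by rw [starSet_union]; exact union_subset h2 h4⟩
  · intro t ht
    obtain ⟨A, h1, h2⟩ := exists_starSet_mem_subset hG (h ht)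
    exact ⟨starSet A, mem_nhdsWithin_of_mem_nhds ((isClopen_starSet A).2.mem_nhds h1), A,
      Subset.rfl, h2⟩

/-! ### Diagonal arguments modulo finite sets -/

/-- Two sequences of sets that are pairwise almost disjoint are separated by one set. -/
theorem exists_starSet_separating (B C : ℕ → Set ℕ)
    (h : ∀ n m, Disjoint (starSet (B n)) (starSet (C m))) :
    ∃ D, (∀ n, starSet (B n) ⊆ starSet D) ∧ ∀ m, Disjoint (starSet (C m)) (starSet D) := by
  have hf : ∀ n m, (B n ∩ C m).Finite := fun n m => by
    rw [← starSet_eq_empty, starSet_inter, ← disjoint_iff_inter_eq_empty]; exact h n m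
  -- Each `B n` loses only its finite intersections with `C 0, …, C n`, while `C m` can meet only
  -- the pieces with `n < m`.
  refine ⟨⋃ n, B n \ ⋃ m ∈ Iic n, C m, fun n => ?_, fun m => ?_⟩
  · rw [starSet_subset]
    refine ((finite_Iic n).biUnion fun m _ => hf n m).subset ?_
    rintro k ⟨hk, hk'⟩
    simp only [mem_iUnion, Set.mem_sdiff, not_exists, not_and, not_forall, not_not] at hk'
    obtain ⟨m, hm, hkm⟩ := hk' n hk
    exact mem_biUnion hm ⟨hk, hkm⟩
  · rw [disjoint_iff_inter_eq_empty, ← starSet_inter, starSet_eq_empty]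
    refine ((finite_Iio m).biUnion fun n _ => hf n m).subset ?_
    rintro k ⟨hk, hk'⟩
    obtain ⟨n, hn, hkn⟩ := mem_iUnion.1 hk'
    refine mem_biUnion (x := n) ?_ ⟨hn, hk⟩
    by_contra hmn
    exact hkn (mem_biUnion (x := m) (mem_Iic.2 (not_lt.1 hmn)) hk)

/-- A decreasing sequence of infinite sets has an infinite pseudo-intersection. -/
theorem exists_starSet_subset_iInter (B : ℕ → Set ℕ) (hB : ∀ n, (B n).Infinite)
    (hd : Antitone fun n => starSet (B n)) :
    ∃ D : Set ℕ, D.Infinite ∧ ∀ n, starSet D ⊆ starSet (B n) := by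
  -- `B 0 ∩ … ∩ B n` is infinite, so an increasing `φ` can take `φ n` from it.
  have hf : ∀ n, ∃ᶠ k in atTop, ∀ i ≤ n, k ∈ B i := fun n => by
    rw [Nat.frequently_atTop_iff_infinite]
    have : (⋃ i ∈ Iic n, B n \ B i).Finite :=
      (finite_Iic n).biUnion fun i hi => starSet_subset.1 (hd hi)
    refine ((hB n).sdiff this).mono ?_
    rintro k ⟨hk, hk'⟩ i hi
    by_contra hki
    exact hk' (mem_biUnion (x := i) hi ⟨hk, hki⟩)
  obtain ⟨φ, hφ, hφB⟩ := extraction_forall_of_frequently hf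
  refine ⟨range φ, infinite_range_of_injective hφ.injective, fun n => starSet_subset.2 ?_⟩
  refine ((finite_Iio n).image φ).subset ?_
  rintro _ ⟨⟨j, rfl⟩, hj⟩
  refine mem_image_of_mem φ ?_
  by_contra hnj
  exact hj (hφB j n (not_lt.1 hnj))

/-! ### Closed nowhere dense `P`-sets -/

section PSets

variable {T : Type*} [TopologicalSpace T]

theorem isPSet_empty : IsPSet (∅ : Set T) := fun _ _ _ => empty_subset _

theorem IsPSet.union {A B : Set T} (hA : IsPSet A) (hB : IsPSet B) : IsPSet (A ∪ B) :=
  fun G hG h => union_subset (hA G hG fun n => subset_union_left.trans (h n))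
    (hB G hG fun n => subset_union_right.trans (h n))

theorem IsPSet.inter_isClopen {A C : Set T} (hA : IsPSet A) (hC : IsClopen C) :
    IsPSet (A ∩ C) := by
  intro G hG h t ht
  have h1 := hA (fun n => G n ∪ Cᶜ) (fun n => (hG n).union hC.compl.2) (fun n s hs => by
    by_cases hsC : s ∈ C
    · exact Or.inl (h n ⟨hs, hsC⟩)
    · exact Or.inr hsC) ht.1
  rw [← iInter_union] at h1
  have h2 : t ∈ interior ((⋂ n, G n) ∪ Cᶜ) ∩ C := ⟨h1, ht.2⟩
  refine interior_maximal ?_ (isOpen_interior.inter hC.2) h2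
  rintro s ⟨hs, hsC⟩
  exact (interior_subset hs).resolve_right fun h => h hsC

theorem empty_mem_nowhereDensePSets : (∅ : Set T) ∈ nowhereDensePSets T :=
  ⟨isClosed_empty, isNowhereDense_empty, isPSet_empty⟩

theorem union_mem_nowhereDensePSets {P Q : Set T} (hP : P ∈ nowhereDensePSets T)
    (hQ : Q ∈ nowhereDensePSets T) : P ∪ Q ∈ nowhereDensePSets T := by
  refine ⟨hP.1.union hQ.1, ?_, hP.2.2.union hQ.2.2⟩
  rw [(hP.1.union hQ.1).isNowhereDense_iff, interior_union_isClosed_of_interior_empty hP.1]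
  · exact hP.1.isNowhereDense_iff.1 hP.2.1
  · exact hQ.1.isNowhereDense_iff.1 hQ.2.1

end PSets

/-- A closed `P`-set of `ℕ*` contained in countably many open sets has a clopen neighbourhood
contained in all of them. -/
theorem IsPSet.exists_starSet {P : Set NStar} (hP : IsPSet P) (hc : IsClosed P)
    {G : ℕ → Set NStar} (hG : ∀ n, IsOpen (G n)) (h : ∀ n, P ⊆ G n) :
    ∃ A, P ⊆ starSet A ∧ ∀ n, starSet A ⊆ G n := by
  obtain ⟨A, h1, h2⟩ := exists_starSet_between hc isOpen_interior (hP G hG h)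
  exact ⟨A, h1, fun n => (h2.trans interior_subset).trans (iInter_subset _ n)⟩

/-- Shrink each `G k` to a clopen `C k`. Each `P n` has a clopen neighbourhood inside all `C k`;
separating these from the complements of the `C k` gives one clopen set that works for the closure.
-/
theorem isPSet_closure_iUnion {P : ℕ → Set NStar} (hc : ∀ n, IsClosed (P n))
    (hP : ∀ n, IsPSet (P n)) : IsPSet (closure (⋃ n, P n)) := by
  intro G hG h
  have hk : ∀ k, ∃ C, closure (⋃ n, P n) ⊆ starSet C ∧ starSet C ⊆ G k := fun k =>
    exists_starSet_between isClosed_closure (hG k) (h k)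
  choose C hC1 hC2 using hk
  have hn : ∀ n, ∃ B, P n ⊆ starSet B ∧ ∀ k, starSet B ⊆ starSet (C k) := fun n =>
    (hP n).exists_starSet (hc n) (fun k => (isClopen_starSet (C k)).2)
      (fun k => (subset_iUnion P n).trans (subset_closure.trans (hC1 k)))
  choose B hB1 hB2 using hn
  obtain ⟨D, hD1, hD2⟩ := exists_starSet_separating B (fun k => (C k)ᶜ) (fun n k => by
    rw [starSet_compl]; exact disjoint_compl_right_iff_subset.2 (hB2 n k))
  have h1 : closure (⋃ n, P n) ⊆ starSet D :=
    closure_minimal (iUnion_subset fun n => (hB1 n).trans (hD1 n)) (isClopen_starSet D).1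
  refine h1.trans (interior_maximal (subset_iInter fun k => ?_) (isClopen_starSet D).2)
  have := hD2 k
  rw [starSet_compl, disjoint_compl_left_iff_subset] at this
  exact this.trans (hC2 k)

/-- A Baire argument: inside a given `A*`, shrink to clopen sets avoiding `P 0, P 1, …` in turn. A
pseudo-intersection gives a nonempty open set missing the whole union, hence also its closure. -/
theorem isNowhereDense_iUnion_nstar {P : ℕ → Set NStar} (hc : ∀ n, IsClosed (P n))
    (hP : ∀ n, IsNowhereDense (P n)) : IsNowhereDense (⋃ n, P n) := by
  rw [IsNowhereDense, eq_empty_iff_forall_notMem]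
  intro t ht
  obtain ⟨A, hA1, hA2⟩ := exists_starSet_mem_subset isOpen_interior ht
  have step : ∀ (n : ℕ) (B : {B : Set ℕ // B.Infinite}),
      ∃ B' : {B : Set ℕ // B.Infinite}, starSet B'.1 ⊆ starSet B.1 \ P n := by
    rintro n ⟨B, hB⟩
    have hne : (starSet B \ P n).Nonempty := by
      rw [nonempty_iff_ne_empty, Ne, sdiff_eq_empty]
      intro hsub
      have h1 := interior_mono hsub
      rw [(isClopen_starSet B).2.interior_eq, (hc n).isNowhereDense_iff.1 (hP n)] at h1
      exact (starSet_nonempty.2 hB).ne_empty (subset_empty_iff.1 h1)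
    obtain ⟨s, hs⟩ := hne
    obtain ⟨B', h1, h2⟩ := exists_starSet_mem_subset
      ((isClopen_starSet B).2.sdiff (hc n)) hs
    exact ⟨⟨B', starSet_nonempty.1 ⟨s, h1⟩⟩, h2⟩
  choose next hnext using step
  let B : ℕ → {B : Set ℕ // B.Infinite} := fun n =>
    Nat.rec ⟨A, starSet_nonempty.1 ⟨t, hA1⟩⟩ (fun n B => next n B) n
  have hB : ∀ n, starSet (B (n + 1)).1 ⊆ starSet (B n).1 \ P n := fun n => hnext n (B n)
  obtain ⟨D, hD, hDB⟩ := exists_starSet_subset_iInter (fun n => (B n).1) (fun n => (B n).2)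
    (antitone_nat_of_succ_le fun n => (hB n).trans sdiff_subset)
  have h1 : closure (⋃ n, P n) ⊆ (starSet D)ᶜ := by
    refine closure_minimal (iUnion_subset fun n s hs hsD => ?_) (isClopen_starSet D).compl.1
    exact (hB n (hDB (n + 1) hsD)).2 hs
  obtain ⟨s, hs⟩ := starSet_nonempty.2 hD
  exact h1 (interior_subset (hA2 (hDB 0 hs))) hs

theorem closure_iUnion_mem_nowhereDensePSets {P : ℕ → Set NStar}
    (hP : ∀ n, P n ∈ nowhereDensePSets NStar) :
    closure (⋃ n, P n) ∈ nowhereDensePSets NStar :=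
  ⟨isClosed_closure, (isNowhereDense_iUnion_nstar (fun n => (hP n).1) fun n => (hP n).2.1).closure,
    isPSet_closure_iUnion (fun n => (hP n).1) fun n => (hP n).2.2⟩

/-! ### Countable compactness and gluing -/

theorem isCountablyCompactSpace_starUnion : IsCountablyCompactSpace ↥starUnion := by
  intro U hU hcov
  by_contra hno
  push Not at hno
  have hy : ∀ n : ℕ, ∃ y : ↥starUnion, y ∉ ⋃ i ∈ Finset.range (n + 1), U i := fun n =>
    (ne_univ_iff_exists_notMem _).1 (hno (Finset.range (n + 1)))
  choose y hy using hy
  choose P hP hyP using fun n => mem_sUnion.1 (y n).2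
  have hQ := closure_iUnion_mem_nowhereDensePSets hP
  set Q := closure (⋃ n, P n)
  have hK : IsCompact (Subtype.val ⁻¹' Q : Set ↥starUnion) := by
    rw [Subtype.isCompact_iff, Subtype.image_preimage_coe,
      inter_eq_right.2 (show Q ⊆ starUnion from subset_sUnion_of_mem hQ)]
    exact hQ.1.isCompact
  obtain ⟨s, hs⟩ := hK.elim_finite_subcover U hU (by rw [hcov]; exact subset_univ _)
  obtain ⟨N, hN⟩ := s.exists_nat_subset_range
  refine hy N ?_
  have hyQ : y N ∈ (Subtype.val ⁻¹' Q : Set ↥starUnion) :=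
    subset_closure (mem_iUnion.2 ⟨N, hyP N⟩)
  obtain ⟨i, hi, hyi⟩ := mem_iUnion₂.1 (hs hyQ)
  exact mem_biUnion (Finset.range_mono (Nat.le_succ N) (hN hi)) hyi

/-- Continuous two-valued functions that agree on the intersections of closed `P`-sets have a
common continuous extension. -/
theorem exists_isClopen_of_compatible {P : ℕ → Set NStar} (hc : ∀ n, IsClosed (P n))
    (hP : ∀ n, IsPSet (P n)) {C : ℕ → Set NStar} (hC : ∀ n, IsClopen (C n))
    (h : ∀ n m, ∀ t ∈ P n, t ∈ P m → (t ∈ C n ↔ t ∈ C m)) :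
    ∃ D, IsClopen D ∧ ∀ n, ∀ t ∈ P n, (t ∈ D ↔ t ∈ C n) := by
  -- `A n` surrounds the part of `P n` with value one and misses every part with value zero; only
  -- then is `B m` chosen around the zero part of `P m`, missing every `A n`.
  have hE : ∀ n, ∃ A, P n ∩ C n ⊆ starSet A ∧ ∀ m, starSet A ⊆ (P m ∩ (C m)ᶜ)ᶜ := fun n =>
    ((hP n).inter_isClopen (hC n)).exists_starSet ((hc n).inter (hC n).1)
      (fun m => ((hc m).inter (hC m).compl.1).isOpen_compl)
      (fun m t ht ht' => ht'.2 ((h n m t ht.1 ht'.1).1 ht.2))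
  choose A hA1 hA2 using hE
  have hF : ∀ m, ∃ B, P m ∩ (C m)ᶜ ⊆ starSet B ∧ ∀ n, starSet B ⊆ (starSet (A n))ᶜ := fun m =>
    ((hP m).inter_isClopen (hC m).compl).exists_starSet ((hc m).inter (hC m).compl.1)
      (fun n => (isClopen_starSet (A n)).compl.2) (fun n => subset_compl_comm.1 (hA2 n m))
  choose B hB1 hB2 using hF
  obtain ⟨D, hD1, hD2⟩ := exists_starSet_separating A B fun n m =>
    disjoint_left.2 fun t h1 h2 => hB2 m n h2 h1
  refine ⟨starSet D, isClopen_starSet D, fun n t ht => ⟨fun htD => ?_, fun htC => ?_⟩⟩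
  · by_contra htC
    exact disjoint_left.1 (hD2 n) (hB1 n ⟨ht, htC⟩) htD
  · exact hD1 n (hA1 n ⟨ht, htC⟩)

/-! ### `P`-sets from measures, and density of `Y` -/

section SmallSets

open MeasureTheory
open scoped ENNReal

/-- The points of `ℕ*` that lie in no `A*` with `A` of finite measure. -/
def infiniteMeasureKernel (μ : Measure ℕ) : Set NStar :=
  (⋃ A : {A : Set ℕ // μ A < ∞}, starSet A.1)ᶜ

variable {μ : Measure ℕ}

theorem isClosed_infiniteMeasureKernel : IsClosed (infiniteMeasureKernel μ) :=
  (isOpen_iUnion fun _ => (isClopen_starSet _).2).isClosed_compl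

theorem exists_starSet_of_compl_kernel {K : Set NStar} (hK : IsClosed K)
    (h : K ⊆ (infiniteMeasureKernel μ)ᶜ) : ∃ A, μ A < ∞ ∧ K ⊆ starSet A := by
  rw [infiniteMeasureKernel, compl_compl] at h
  have : Nonempty {A : Set ℕ // μ A < ∞} := ⟨⟨∅, by simp⟩⟩
  obtain ⟨A, hA⟩ := hK.isCompact.elim_directed_cover _
    (fun A : {A : Set ℕ // μ A < ∞} => (isClopen_starSet A.1).2) h
    (fun A B => ⟨⟨A.1 ∪ B.1, measure_union_lt_top A.2 B.2⟩,
      by rw [starSet_union]; exact subset_union_left,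
      by rw [starSet_union]; exact subset_union_right⟩)
  exact ⟨A.1, A.2, hA⟩

/-- The sets of finite measure form a `P`-ideal. -/
theorem exists_almost_superset {A : ℕ → Set ℕ} (hA : ∀ n, μ (A n) < ∞) :
    ∃ B, μ B < ∞ ∧ ∀ n, (A n \ B).Finite := by
  -- Discarding a finite initial segment of `A n` leaves measure at most `2⁻ⁿ`, so the union of the
  -- tails has finite measure.
  have hk : ∀ n, ∃ k, μ (A n ∩ Ici k) ≤ 2⁻¹ ^ n := fun n => by
    have h1 := tendsto_measure_iInter_atTop (μ := μ) (s := fun k : ℕ => A n ∩ Ici k)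
      (fun _ => MeasurableSet.nullMeasurableSet (.of_discrete))
      (fun i j hij => inter_subset_inter_right _ (Ici_subset_Ici.2 hij))
      ⟨0, ((measure_mono inter_subset_left).trans_lt (hA n)).ne⟩
    have h2 : ⋂ k : ℕ, A n ∩ Ici k = ∅ := by
      rw [eq_empty_iff_forall_notMem]
      intro m hm
      exact absurd (mem_iInter.1 hm (m + 1)).2 (by simp)
    rw [h2, measure_empty] at h1
    have h3 : (0 : ℝ≥0∞) < 2⁻¹ ^ n := ENNReal.pow_pos (by simp) n
    obtain ⟨k, hk⟩ := (h1.eventually (gt_mem_nhds h3)).exists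
    exact ⟨k, hk.le⟩
  choose k hk using hk
  refine ⟨⋃ n, A n ∩ Ici (k n), ?_, fun n => ?_⟩
  · refine (measure_iUnion_le _).trans_lt ((ENNReal.tsum_le_tsum hk).trans_lt ?_)
    rw [ENNReal.tsum_geometric]
    simp
  · refine (finite_Iio (k n)).subset ?_
    rintro m ⟨hm, hm'⟩
    by_contra h
    exact hm' (mem_iUnion.2 ⟨n, hm, mem_Ici.2 (not_lt.1 h)⟩)

/-- By compactness the complement of each `G n` lies in one `(A n)*` of finite measure; an almost
superset `B` of all `A n` makes `(B*)ᶜ` the needed neighbourhood. -/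
theorem isPSet_infiniteMeasureKernel : IsPSet (infiniteMeasureKernel μ) := by
  intro G hG h
  choose A hA1 hA2 using fun n => exists_starSet_of_compl_kernel (hG n).isClosed_compl
    (compl_subset_compl.2 (h n))
  obtain ⟨B, hB1, hB2⟩ := exists_almost_superset hA1
  have h1 : infiniteMeasureKernel μ ⊆ (starSet B)ᶜ :=
    compl_subset_compl.2 (subset_iUnion (fun A : {A : Set ℕ // μ A < ∞} => starSet A.1) ⟨B, hB1⟩)
  refine h1.trans (interior_maximal (subset_iInter fun n => ?_) (isClopen_starSet B).compl.2)
  exact compl_subset_comm.1 ((hA2 n).trans (starSet_subset.2 (hB2 n)))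

/-- If the measures of points tend to zero, every infinite set has an infinite subset of finite
measure. -/
theorem exists_infinite_subset_measure_lt_top (h0 : Tendsto (fun n => μ {n}) atTop (𝓝 0))
    {B : Set ℕ} (hB : B.Infinite) : ∃ C ⊆ B, C.Infinite ∧ μ C < ∞ := by
  have hf : ∀ n, ∃ᶠ k in atTop, k ∈ B ∧ μ {k} ≤ 2⁻¹ ^ n := fun n => by
    have h3 : (0 : ℝ≥0∞) < 2⁻¹ ^ n := ENNReal.pow_pos (by simp) n
    exact (Nat.frequently_atTop_iff_infinite.2 hB).and_eventually
      ((h0.eventually (gt_mem_nhds h3)).mono fun _ h => h.le)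
  obtain ⟨φ, hφ, hφB⟩ := extraction_forall_of_frequently hf
  refine ⟨range φ, range_subset_iff.2 fun n => (hφB n).1,
    infinite_range_of_injective hφ.injective, ?_⟩
  rw [← iUnion_singleton_eq_range]
  refine (measure_iUnion_le _).trans_lt ((ENNReal.tsum_le_tsum fun n => (hφB n).2).trans_lt ?_)
  rw [ENNReal.tsum_geometric]
  simp

theorem infiniteMeasureKernel_mem (h0 : Tendsto (fun n => μ {n}) atTop (𝓝 0)) :
    infiniteMeasureKernel μ ∈ nowhereDensePSets NStar := by
  refine ⟨isClosed_infiniteMeasureKernel, ?_, isPSet_infiniteMeasureKernel⟩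
  rw [isClosed_infiniteMeasureKernel.isNowhereDense_iff, eq_empty_iff_forall_notMem]
  intro t ht
  obtain ⟨B, hB1, hB2⟩ := exists_starSet_mem_subset isOpen_interior ht
  obtain ⟨C, hCB, hC, hCμ⟩ := exists_infinite_subset_measure_lt_top h0
    (starSet_nonempty.1 ⟨t, hB1⟩)
  obtain ⟨s, hs⟩ := starSet_nonempty.2 hC
  refine interior_subset (hB2 ?_) (mem_iUnion.2 ⟨⟨C, hCμ⟩, hs⟩)
  exact starSet_subset.2 (by rw [sdiff_eq_empty.2 hCB]; exact finite_empty) hs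

/-- Otherwise `B` would be almost contained in a set of finite measure; the finite remainder also
has finite measure. -/
theorem infiniteMeasureKernel_inter_nonempty (hfin : ∀ n, μ {n} < ∞) {B : Set ℕ}
    (hB : μ B = ∞) :
    (starSet B ∩ infiniteMeasureKernel μ).Nonempty := by
  by_contra h
  have h1 : starSet B ⊆ (infiniteMeasureKernel μ)ᶜ :=
    fun t ht ht' => h ⟨t, ht, ht'⟩
  obtain ⟨A, hA, hBA⟩ := exists_starSet_of_compl_kernel (isClopen_starSet B).1 h1
  have hd : μ (B \ A) < ∞ := by
    rw [← biUnion_of_singleton (B \ A)]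
    exact measure_biUnion_lt_top (starSet_subset.1 hBA) fun n _ => hfin n
  refine (((measure_mono ?_).trans_lt (measure_union_lt_top hd hA)).ne hB)
  rw [sdiff_union_self]
  exact subset_union_left

open scoped Classical in
theorem exists_measure_nat {B : Set ℕ} (hB : B.Infinite) :
    ∃ μ : Measure ℕ, Tendsto (fun n => μ {n}) atTop (𝓝 0) ∧ μ B = ∞ ∧ ∀ n, μ {n} < ∞ := by
  replace hB : {n | n ∈ B}.Infinite := hB
  -- The `n`-th element of `B` gets weight `1 / (n + 1)`, so the mass of `B` is the harmonic series;
  -- off `B` the weights still tend to `0`.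
  let w : ℕ → ℝ≥0∞ := fun n => ((Nat.count (· ∈ B) n : ℕ) + 1 : ℝ≥0∞)⁻¹
  have hw : ∀ n, (Measure.count.withDensity w) {n} = w n := fun n => by
    rw [withDensity_apply _ (measurableSet_singleton n)]; simp
  refine ⟨Measure.count.withDensity w, ?_, ?_, ?_⟩
  · simp_rw [hw]
    have h1 : Tendsto (fun n => Nat.count (· ∈ B) n) atTop atTop :=
      tendsto_atTop_atTop_of_monotone (Nat.count_monotone _) fun n =>
        ⟨Nat.nth (· ∈ B) n, (Nat.count_nth_of_infinite (p := (· ∈ B)) hB n).ge⟩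
    have h2 : Tendsto (fun n : ℕ => ((n : ℝ≥0∞) + 1)⁻¹) atTop (𝓝 0) := by
      have := ENNReal.tendsto_inv_nat_nhds_zero.comp (tendsto_add_atTop_nat 1)
      simpa [Function.comp_def] using this
    exact h2.comp h1
  · have hnth : ∀ n, Nat.nth (· ∈ B) n ∈ B := fun n => Nat.nth_mem_of_infinite (p := (· ∈ B)) hB n
    rw [withDensity_apply _ .of_discrete, ← lintegral_indicator .of_discrete, lintegral_count,
      eq_top_iff]
    refine le_trans (le_of_eq ?_) (ENNReal.tsum_comp_le_tsum_of_injective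
      (Nat.nth_injective (p := (· ∈ B)) hB) _)
    have : ∀ n, B.indicator w (Nat.nth (· ∈ B) n) = ((n : ℝ≥0∞) + 1)⁻¹ := fun n => by
      rw [indicator_of_mem (hnth n)]
      simp only [w]
      rw [Nat.count_nth_of_infinite (p := (· ∈ B)) hB]
    rw [tsum_congr this]
    by_contra hne
    have h1 := ENNReal.summable_toReal (Ne.symm hne)
    refine Real.not_summable_one_div_natCast ((summable_nat_add_iff 1).1 (h1.congr fun n => ?_))
    rw [ENNReal.toReal_inv, ENNReal.toReal_add (by simp) (by simp)]
    simp
  · intro n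
    rw [hw]
    simp [w]

end SmallSets

theorem dense_starUnion : Dense starUnion := by
  rw [dense_iff_inter_open]
  rintro G hG ⟨t, ht⟩
  obtain ⟨B, hB1, hB2⟩ := exists_starSet_mem_subset hG ht
  obtain ⟨μ, h0, hμ, hfin⟩ := exists_measure_nat (starSet_nonempty.1 ⟨t, hB1⟩)
  obtain ⟨s, hs1, hs2⟩ := infiniteMeasureKernel_inter_nonempty hfin hμ
  exact ⟨s, hB2 hs1, mem_sUnion.2 ⟨_, infiniteMeasureKernel_mem h0, hs2⟩⟩

/-! ### The space `X`, the Choquet game and the evaluation map -/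

theorem StarMaps.continuous_map (x : StarMaps) : Continuous x.map := x.2

/-- As `{0,1}` is uniformly discrete, uniform closeness on `P` amounts to equality on `P`; `𝒫` is
directed under finite unions. -/
theorem StarMaps.hasBasis_nhds (x : StarMaps) :
    (𝓝 x).HasBasis (fun P : Set NStar => P ∈ nowhereDensePSets NStar)
      (fun P => {x' : StarMaps | ∀ t ∈ P, x'.map t = x.map t}) := by
  have hu : (uniformity ↥({0, 1} : Set ℝ)).HasBasis (fun _ : Unit => True)
      (fun _ => {p | p.1 = p.2}) := by
    rw [DiscreteUniformity.eq_principal_setRelId]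
    exact hasBasis_principal _
  have h := UniformOnFun.hasBasis_nhds_of_basis NStar ↥({0, 1} : Set ℝ) (nowhereDensePSets NStar)
    x.1 ⟨∅, empty_mem_nowhereDensePSets⟩ (fun P hP Q hQ => ⟨P ∪ Q,
      union_mem_nowhereDensePSets hP hQ, subset_union_left, subset_union_right⟩) hu
  rw [nhds_subtype_eq_comap]
  refine (h.comap _).to_hasBasis (fun i hi => ⟨i.1, hi.1, fun x' hx' => hx'⟩)
    (fun P hP => ⟨(P, ()), ⟨hP, trivial⟩, fun x' hx' => hx'⟩)

/-- The maps that agree with `x` on `P`. -/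
def StarMaps.agree (x : StarMaps) (P : Set NStar) : Set StarMaps :=
  {x' | ∀ t ∈ P, x'.map t = x.map t}

theorem StarMaps.isOpen_agree (x : StarMaps) {P : Set NStar} (hP : P ∈ nowhereDensePSets NStar) :
    IsOpen (x.agree P) := by
  refine isOpen_iff_mem_nhds.2 fun x' hx' => ?_
  filter_upwards [x'.hasBasis_nhds.mem_of_mem hP] with z hz t ht
  exact (hz t ht).trans (hx' t ht)

theorem StarMaps.mem_agree_self (x : StarMaps) (P : Set NStar) : x ∈ x.agree P := fun _ _ => rfl

open scoped Classical in
/-- The element of `StarMaps` that agrees with `y` on the clopen set `D` and with `x` off it. -/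
noncomputable def StarMaps.update (x : StarMaps) (D : Set NStar) (hD : IsClopen D)
    (y : StarMaps) : StarMaps :=
  ⟨UniformOnFun.ofFun _ (D.piecewise y.map x.map),
    y.continuous_map.piecewise (by simp [hD.frontier_eq]) x.continuous_map⟩

/-- The constant elements of `StarMaps`. -/
def StarMaps.const (a : ↥({0, 1} : Set ℝ)) : StarMaps :=
  ⟨UniformOnFun.ofFun _ fun _ => a, continuous_const⟩

theorem StarMaps.update_map_of_mem (x y : StarMaps) {D : Set NStar} (hD : IsClopen D) {t : NStar}
    (ht : t ∈ D) : (x.update D hD y).map t = y.map t := by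
  classical exact piecewise_eq_of_mem D y.map x.map ht

theorem StarMaps.update_map_of_notMem (x y : StarMaps) {D : Set NStar} (hD : IsClopen D)
    {t : NStar} (ht : t ∉ D) : (x.update D hD y).map t = x.map t := by
  classical exact piecewise_eq_of_notMem D y.map x.map ht

@[simp]
theorem StarMaps.const_map (a : ↥({0, 1} : Set ℝ)) (t : NStar) : (StarMaps.const a).map t = a :=
  rfl

theorem zero_or_one_of_mem (a : ↥({0, 1} : Set ℝ)) :
    a = ⟨0, by simp⟩ ∨ a = ⟨1, by simp⟩ := by
  obtain ⟨a, ha⟩ := a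
  simpa [Subtype.ext_iff] using ha

theorem StarMaps.isClopen_setOf_map_eq (x : StarMaps) (a : ↥({0, 1} : Set ℝ)) :
    IsClopen {t | x.map t = a} :=
  (isClopen_discrete {a}).preimage x.continuous_map

theorem exists_starMaps_of_compatible {P : ℕ → Set NStar}
    (hP : ∀ n, P n ∈ nowhereDensePSets NStar) (x : ℕ → StarMaps)
    (h : ∀ n m, ∀ t ∈ P n, t ∈ P m → (x n).map t = (x m).map t) :
    ∃ z : StarMaps, ∀ n, z ∈ (x n).agree (P n) := by
  obtain ⟨D, hD, hDx⟩ := exists_isClopen_of_compatible (fun n => (hP n).1) (fun n => (hP n).2.2)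
    (fun n => (x n).isClopen_setOf_map_eq ⟨1, by simp⟩)
    (fun n m t hn hm => by rw [mem_ofPred_eq, mem_ofPred_eq, h n m t hn hm])
  refine ⟨(StarMaps.const ⟨0, by simp⟩).update D hD (StarMaps.const ⟨1, by simp⟩),
    fun n t ht => ?_⟩
  by_cases htD : t ∈ D
  · rw [StarMaps.update_map_of_mem _ _ hD htD, StarMaps.const_map]
    exact ((hDx n t ht).1 htD).symm
  · rw [StarMaps.update_map_of_notMem _ _ hD htD, StarMaps.const_map]
    exact ((zero_or_one_of_mem _).resolve_right fun h1 => htD ((hDx n t ht).2 h1)).symm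

theorem isAlphaFavourable_starMaps : IsAlphaFavourable StarMaps := by
  have hch : ∀ U : NonemptyOpen StarMaps, ∃ p : StarMaps × Set NStar,
      p.2 ∈ nowhereDensePSets NStar ∧ p.1.agree p.2 ⊆ U.1 := by
    rintro ⟨U, hU, x, hx⟩
    obtain ⟨P, hP, hPU⟩ := x.hasBasis_nhds.mem_iff.1 (hU.mem_nhds hx)
    exact ⟨(x, P), hP, hPU⟩
  choose p hp hpU using hch
  refine ⟨⟨fun n U => ⟨(p (U (Fin.last n))).1.agree (p (U (Fin.last n))).2,
    StarMaps.isOpen_agree _ (hp _), _, StarMaps.mem_agree_self _ _⟩, fun n U => hpU _⟩, ?_⟩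
  intro U hU
  let V : ℕ → Set StarMaps := fun n => (p (U n)).1.agree (p (U n)).2
  have hV : ∀ n, V (n + 1) ⊆ V n := fun n => (hpU (U (n + 1))).trans (hU n)
  have hanti : Antitone V := antitone_nat_of_succ_le hV
  -- The later centre lies in `V m ⊆ V n`, so it agrees with the earlier one on the earlier `P`-set.
  have hcomp : ∀ n m, n ≤ m → ∀ t ∈ (p (U n)).2, (p (U m)).1.map t = (p (U n)).1.map t :=
    fun n m hnm => hanti hnm (StarMaps.mem_agree_self _ _)
  obtain ⟨z, hz⟩ := exists_starMaps_of_compatible (fun n => hp (U n)) (fun n => (p (U n)).1)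
    (fun n m t hn hm => by
      rcases le_total n m with h | h
      · exact (hcomp n m h t hn).symm
      · exact hcomp m n h t hm)
  exact ⟨z, mem_iInter.2 hz⟩

theorem isSeparatelyContinuous_starEval : IsSeparatelyContinuous starEval := by
  refine ⟨fun x => continuous_subtype_val.comp (x.continuous_map.comp continuous_subtype_val),
    fun y => continuous_iff_continuousAt.2 fun x => ?_⟩
  obtain ⟨P, hP, hyP⟩ := mem_sUnion.1 y.2
  refine Filter.EventuallyEq.continuousAt (y := starEval x y) ?_
  filter_upwards [x.hasBasis_nhds.mem_of_mem hP] with x' hx'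
  exact congrArg Subtype.val (hx' _ hyP)

theorem StarMaps.exists_agree_ne (x : StarMaps) {P : Set NStar} (hP : IsClosed P) {t : NStar}
    (ht : t ∉ P) : ∃ x' ∈ x.agree P, (x'.map t : ℝ) ≠ x.map t := by
  obtain ⟨A, h1, h2⟩ := exists_starSet_mem_subset hP.isOpen_compl ht
  obtain ⟨a, ha⟩ : ∃ a : ↥({0, 1} : Set ℝ), (a : ℝ) ≠ x.map t := by
    rcases zero_or_one_of_mem (x.map t) with h | h
    · exact ⟨⟨1, by simp⟩, by simp [h]⟩
    · exact ⟨⟨0, by simp⟩, by simp [h]⟩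
  refine ⟨x.update (starSet A) (isClopen_starSet A) (StarMaps.const a), fun s hs => ?_, ?_⟩
  · exact StarMaps.update_map_of_notMem _ _ _ fun h => h2 h hs
  · rwa [StarMaps.update_map_of_mem _ _ _ h1]

theorem not_continuousAt_starEval (p : StarMaps × ↥starUnion) :
    ¬ ContinuousAt (fun q : StarMaps × ↥starUnion => starEval q.1 q.2) p := by
  obtain ⟨x, y⟩ := p
  intro h
  have h1 : ∀ᶠ q : StarMaps × ↥starUnion in 𝓝 x ×ˢ 𝓝 y,
      |starEval q.1 q.2 - starEval x y| < 1 / 2 := by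
    rw [← nhds_prod_eq]
    exact h.eventually (Metric.ball_mem_nhds _ (by norm_num : (0 : ℝ) < 1 / 2))
  obtain ⟨u, hu, v, hv, huv⟩ := eventually_prod_iff.1 h1
  obtain ⟨P, hP, hPu⟩ := x.hasBasis_nhds.mem_iff.1 hu
  obtain ⟨W, hW, hWv⟩ := mem_nhds_subtype _ _ _ |>.1 hv
  obtain ⟨G, hGW, hG, hyG⟩ := mem_nhds_iff.1 hW
  have hne : (G \ P).Nonempty := by
    rw [nonempty_iff_ne_empty, Ne, sdiff_eq_empty]
    intro hsub
    have := interior_mono hsub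
    rw [hG.interior_eq, hP.1.isNowhereDense_iff.1 hP.2.1] at this
    exact this hyG
  obtain ⟨t, ⟨htG, htP⟩, htY⟩ := dense_starUnion.inter_open_nonempty _ (hG.sdiff hP.1) hne
  obtain ⟨x', hx', hne'⟩ := x.exists_agree_ne hP.1 htP
  have hvt : v ⟨t, htY⟩ := hWv (show t ∈ W from hGW htG)
  have e1 := huv (hPu (StarMaps.mem_agree_self x P)) hvt
  have e2 := huv (hPu hx') hvt
  simp only [starEval] at e1 e2
  rw [abs_lt] at e1 e2
  rcases zero_or_one_of_mem (x.map t) with a | a <;>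
    rcases zero_or_one_of_mem (x'.map t) with b | b <;>
    simp only [a, b, ne_eq, not_true_eq_false] at e1 e2 hne' <;> linarith [e1.1, e1.2, e2.1, e2.2]

theorem mainTheorem2 :
    (∀ x : StarMaps, (𝓝 x).HasBasis (fun P : Set NStar => P ∈ nowhereDensePSets NStar)
      (fun P => {x' : StarMaps | ∀ t ∈ P, x'.map t = x.map t})) ∧
    Dense starUnion ∧
    IsCountablyCompactSpace ↥starUnion ∧
    IsAlphaFavourable StarMaps ∧
    IsSeparatelyContinuous starEval ∧
    ∀ p : StarMaps × ↥starUnion,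
      ¬ ContinuousAt (fun q : StarMaps × ↥starUnion => starEval q.1 q.2) p :=
  ⟨StarMaps.hasBasis_nhds, dense_starUnion, isCountablyCompactSpace_starUnion,
    isAlphaFavourable_starMaps, isSeparatelyContinuous_starEval, not_continuousAt_starEval⟩
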